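/- Let $G$ be a finite simple graph. A fractional edge-cover of $G$ by subgraphs of a given kind assigns nonnegative real weights to the (not necessarily induced) subgraphs $H$ of $G$ of that kind so that for every edge $e$ of $G$ the weights of the subgraphs containing $e$ sum to at least $1$; the weight with which it covers a vertex $v$ is the sum of the weights of the subgraphs containing $v$. A star is a graph $K_{1,m}$, $m\ge 0$. (1) For every integer $d\ge 2$ and every $g$ there is a finite $d$-regular graph $G$ containing a cycle and of girth greater than $g$ such that every fractional edge-cover of $G$ by stars, and also every fractional edge-cover of $G$ by complete multipartite subgraphs, covers some vertex of $G$ with weight at least $(d+1)/2$. (2) In contrast, every finite tree has an edge-cover by stars (that is, a fractional edge-cover by stars all of whose weights are $0$ or $1$) in which every vertex is covered at most twice. -/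

import Mathlib

/-- The subgraph `H` is a star `K_{1,m}`: some vertex `c` of `H` is adjacent in `H` to all other
vertices of `H`, and there are no further edges. -/
def SimpleGraph.Subgraph.IsStar {V : Type*} {G : SimpleGraph V} (H : G.Subgraph) : Prop :=
  ∃ c : H.verts, H.coe = SimpleGraph.starGraph c

/-- The subgraph `H` (not necessarily induced) is, as a graph on its own vertex set, a complete
multipartite graph (with any number of parts). -/
def SimpleGraph.Subgraph.IsMultipartite {V : Type*} {G : SimpleGraph V} (H : G.Subgraph) : Prop :=
  H.coe.IsCompleteMultipartite

open Classical in
/-- The total weight with which the edge `uv` is covered by the weighted subgraphs `w`. -/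
noncomputable def edgeWeight {V : Type*} {G : SimpleGraph V} (w : G.Subgraph →₀ ℝ) (u v : V) : ℝ :=
  ∑ H ∈ w.support with H.Adj u v, w H

open Classical in
/-- The total weight with which the vertex `v` is covered by the weighted subgraphs `w`. -/
noncomputable def vertexWeight {V : Type*} {G : SimpleGraph V} (w : G.Subgraph →₀ ℝ) (v : V) : ℝ :=
  ∑ H ∈ w.support with v ∈ H.verts, w H

/-- `w` is a fractional edge-cover of `G` by subgraphs with the property `P`: nonnegative weights
on finitely many subgraphs with property `P`, such that every edge of `G` gets total weight at
least one. -/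
structure IsFractionalEdgeCover {V : Type*} {G : SimpleGraph V} (P : G.Subgraph → Prop)
    (w : G.Subgraph →₀ ℝ) : Prop where
  nonneg : ∀ H, 0 ≤ w H
  prop_of_ne_zero : ∀ H, w H ≠ 0 → P H
  one_le_edgeWeight : ∀ u v, G.Adj u v → 1 ≤ edgeWeight w u v

/-! The lower bound is double counting. A star in a `d`-regular graph has `m ≤ d` edges and `m + 1`
vertices, hence at most `d / (d + 1)` edges per vertex. The edge weights total at least `n * d / 2`,
so the vertex weights total at least `n * (d + 1) / 2`, and some vertex reaches the average. Girth
above 4 reduces complete multipartite subgraphs to stars and edgeless graphs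
(`IsMultipartite.isStarOrEdgeless`).

Regular graphs of large girth are Cayley graphs of involutions acting on short reduced words: a
short cycle would be a nonempty reduced word acting trivially. For a tree, root it and take the star
of each vertex with its children. -/

/-- The subgraph has no edges, or it is a star. -/
def SimpleGraph.Subgraph.IsStarOrEdgeless {V : Type*} {G : SimpleGraph V} (H : G.Subgraph) :
    Prop :=
  (∀ u v, ¬ H.Adj u v) ∨
    ∃ c ∈ H.verts, (∀ v ∈ H.verts, v ≠ c → H.Adj c v) ∧ ∀ u v, H.Adj u v → u = c ∨ v = c

theorem SimpleGraph.Subgraph.IsStar.isStarOrEdgeless {V : Type*} {G : SimpleGraph V}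
    {H : G.Subgraph} (h : H.IsStar) : H.IsStarOrEdgeless := by
  obtain ⟨c, hc⟩ := h
  have key : ∀ u v : H.verts, H.Adj u v ↔ u ≠ v ∧ (u = c ∨ v = c) := fun u v => by
    rw [← SimpleGraph.starGraph_adj, ← hc, SimpleGraph.Subgraph.coe_adj]
  refine Or.inr ⟨c, c.2, fun v hv hvc => ?_, fun u v huv => ?_⟩
  · refine (key c ⟨v, hv⟩).2 ⟨fun h => hvc ?_, Or.inl rfl⟩
    rw [h]
  · rcases ((key ⟨u, H.edge_vert huv⟩ ⟨v, H.edge_vert huv.symm⟩).1 huv).2 with h | h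
    · exact Or.inl (congrArg Subtype.val h)
    · exact Or.inr (congrArg Subtype.val h)

/-- Non-adjacency is transitive. If neither end of an edge `ab` dominates, a non-neighbour `y` of
`a` and a non-neighbour `x` of `b` close a 4-cycle `a x y b`. An edge avoiding a dominating vertex
would give a triangle. -/
theorem SimpleGraph.Subgraph.IsMultipartite.isStarOrEdgeless {V : Type*} {G : SimpleGraph V}
    (h3 : ∀ a b c, G.Adj a b → G.Adj b c → G.Adj c a → False)
    (h4 : ∀ a b c d, G.Adj a b → G.Adj b c → G.Adj c d → G.Adj d a → a ≠ c → b ≠ d → False)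
    {H : G.Subgraph} (h : H.IsMultipartite) : H.IsStarOrEdgeless := by
  by_cases he : ∀ u v, ¬ H.Adj u v
  · exact Or.inl he
  push Not at he
  obtain ⟨a, b, hab⟩ := he
  have trans : ∀ x ∈ H.verts, ∀ y ∈ H.verts, ∀ z ∈ H.verts,
      ¬ H.Adj x y → ¬ H.Adj y z → ¬ H.Adj x z := fun x hx y hy z hz h1 h2 =>
    h.trans (⟨x, hx⟩ : H.verts) ⟨y, hy⟩ ⟨z, hz⟩ h1 h2
  have ha := H.edge_vert hab
  have hb := H.edge_vert hab.symm
  have tri : ∀ x y z, H.Adj x y → H.Adj y z → ¬ H.Adj z x := fun x y z h1 h2 h3' =>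
    h3 x y z h1.adj_sub h2.adj_sub h3'.adj_sub
  have center : (∀ v ∈ H.verts, v ≠ a → H.Adj a v) ∨ (∀ v ∈ H.verts, v ≠ b → H.Adj b v) := by
    by_contra! hcon
    obtain ⟨⟨y, hy, hya, hay⟩, ⟨x, hx, hxb, hbx⟩⟩ := hcon
    have hyb : H.Adj y b := by
      by_contra hyb
      exact trans a ha y hy b hb hay hyb hab
    have hxa : H.Adj x a := by
      by_contra hxa
      exact trans b hb x hx a ha hbx hxa hab.symm
    have hxy : H.Adj x y := by
      by_contra hxy
      exact trans b hb x hx y hy hbx hxy hyb.symm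
    exact h4 a x y b hxa.symm.adj_sub hxy.adj_sub hyb.adj_sub hab.symm.adj_sub hya.symm hxb
  have edges : ∀ c, (∀ v ∈ H.verts, v ≠ c → H.Adj c v) →
      ∀ u v, H.Adj u v → u = c ∨ v = c := fun c hc u v huv => by
    by_contra! hne
    exact tri c u v (hc u (H.edge_vert huv) hne.1) huv
      (hc v (H.edge_vert huv.symm) hne.2).symm
  rcases center with hc | hc
  · exact Or.inr ⟨a, ha, hc, edges a hc⟩
  · exact Or.inr ⟨b, hb, hc, edges b hc⟩

-- Ordered pairs count each edge twice; for a star with `m` edges the inequality amounts to `m ≤ d`.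
open Finset Classical in
theorem SimpleGraph.Subgraph.IsStarOrEdgeless.card_le {V : Type*} [Fintype V]
    {G : SimpleGraph V} [DecidableRel G.Adj] {d : ℕ} (hG : G.IsRegularOfDegree d)
    {H : G.Subgraph} (h : H.IsStarOrEdgeless) :
    (d + 1) * #{p : V × V | H.Adj p.1 p.2} ≤ 2 * d * #{v | v ∈ H.verts} := by
  rcases h with h | ⟨c, hc, hcv, hedge⟩
  · simp [h]
  set S : Finset V := ({v | v ∈ H.verts} : Finset V).erase c with hS
  have hcard : #{v | v ∈ H.verts} = #S + 1 :=
    (card_erase_add_one (by simpa using hc)).symm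
  have hSd : #S ≤ d := by
    rw [← hG.degree_eq c, ← G.card_neighborFinset_eq_degree]
    refine card_le_card fun v hv => ?_
    simp only [hS, mem_erase, mem_filter, mem_univ, true_and] at hv
    simpa using (hcv v hv.2 hv.1).adj_sub
  have hD : #{p : V × V | H.Adj p.1 p.2} ≤ #S + #S := by
    calc #{p : V × V | H.Adj p.1 p.2}
        ≤ #(S.image (fun v => (c, v)) ∪ S.image (fun v => (v, c))) := by
          refine card_le_card fun p hp => ?_
          obtain ⟨u, v⟩ := p
          simp only [mem_filter, mem_univ, true_and] at hp
          have hu := H.edge_vert hp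
          have hv := H.edge_vert hp.symm
          have hne := hp.ne
          rcases hedge u v hp with rfl | rfl
          · exact mem_union_left _ (mem_image.2 ⟨v, by simp [hS, hv, hne.symm], rfl⟩)
          · exact mem_union_right _ (mem_image.2 ⟨u, by simp [hS, hu, hne], rfl⟩)
      _ ≤ #S + #S := (card_union_le _ _).trans (Nat.add_le_add card_image_le card_image_le)
  rw [hcard]
  nlinarith [Nat.mul_le_mul_left (d + 1) hD]

open Finset Classical in
theorem exists_le_vertexWeight_of_isStarOrEdgeless {V : Type*} [Fintype V] [Nonempty V]
    {G : SimpleGraph V} [DecidableRel G.Adj] {d : ℕ} (hd : 0 < d) (hG : G.IsRegularOfDegree d)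
    {P : G.Subgraph → Prop} (hP : ∀ H, P H → H.IsStarOrEdgeless) {w : G.Subgraph →₀ ℝ}
    (hw : IsFractionalEdgeCover P w) : ∃ v, ((d : ℝ) + 1) / 2 ≤ vertexWeight w v := by
  have hd' : (0 : ℝ) < d := by exact_mod_cast hd
  have hvert : ∑ v, vertexWeight w v = ∑ H ∈ w.support, w H * #{v | v ∈ H.verts} := by
    simp only [vertexWeight, sum_filter]
    rw [sum_comm]
    refine sum_congr rfl fun H _ => ?_
    rw [← sum_filter, sum_const, nsmul_eq_mul, mul_comm]
  have hedge : ∑ p : V × V, edgeWeight w p.1 p.2 =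
      ∑ H ∈ w.support, w H * #{p : V × V | H.Adj p.1 p.2} := by
    simp only [edgeWeight, sum_filter]
    rw [sum_comm]
    refine sum_congr rfl fun H _ => ?_
    rw [← sum_filter, sum_const, nsmul_eq_mul, mul_comm]
  have hnonneg : ∀ u v, 0 ≤ edgeWeight w u v := fun u v =>
    sum_nonneg fun H _ => hw.nonneg H
  have hlow : (Fintype.card V : ℝ) * d ≤ ∑ p : V × V, edgeWeight w p.1 p.2 := by
    rw [Fintype.sum_prod_type]
    calc (Fintype.card V : ℝ) * d = ∑ _u : V, (d : ℝ) := by simp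
      _ ≤ _ := sum_le_sum fun u _ => ?_
    calc (d : ℝ) = ∑ _v ∈ G.neighborFinset u, (1 : ℝ) := by
          simp [hG.degree_eq u]
      _ ≤ ∑ v ∈ G.neighborFinset u, edgeWeight w u v :=
          sum_le_sum fun v hv => hw.one_le_edgeWeight u v (by simpa using hv)
      _ ≤ ∑ v, edgeWeight w u v :=
          sum_le_sum_of_subset_of_nonneg (subset_univ _) fun v _ _ => hnonneg u v
  have hcmp : ((d : ℝ) + 1) * ∑ p : V × V, edgeWeight w p.1 p.2 ≤
      2 * d * ∑ v, vertexWeight w v := by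
    rw [hvert, hedge, mul_sum, mul_sum]
    refine sum_le_sum fun H hH => ?_
    have h := (hP H (hw.prop_of_ne_zero H (Finsupp.mem_support_iff.1 hH))).card_le hG
    have h' : ((d : ℝ) + 1) * #{p : V × V | H.Adj p.1 p.2} ≤ 2 * d * #{v | v ∈ H.verts} := by
      exact_mod_cast h
    nlinarith [mul_le_mul_of_nonneg_left h' (hw.nonneg H)]
  have hsum : ∑ _v : V, ((d : ℝ) + 1) / 2 ≤ ∑ v, vertexWeight w v := by
    rw [sum_const, card_univ, nsmul_eq_mul]
    have h := (mul_le_mul_of_nonneg_left hlow (by positivity : (0 : ℝ) ≤ d + 1)).trans hcmp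
    refine le_of_mul_le_mul_left ?_ (by positivity : (0 : ℝ) < 2 * d)
    linarith
  obtain ⟨v, -, hv⟩ := exists_le_of_sum_le univ_nonempty hsum
  exact ⟨v, hv⟩

/-! ### Short cycles, and distances in acyclic graphs. -/

namespace SimpleGraph

variable {V : Type*} {G : SimpleGraph V}

theorem no_triangle_of_girth (h : 3 < G.girth) (a b c : V) (hab : G.Adj a b) (hbc : G.Adj b c)
    (hca : G.Adj c a) : False := by
  have hcyc : (Walk.cons hab (Walk.cons hbc (Walk.cons hca Walk.nil))).IsCycle := by
    simp [Walk.cons_isCycle_iff, Walk.cons_isPath_iff, hab.ne, hbc.ne, hca.ne,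
      hca.ne', hab.ne']
  have := girth_le_length hcyc
  simp at this
  omega

theorem no_square_of_girth (h : 4 < G.girth) (a b c d : V) (hab : G.Adj a b) (hbc : G.Adj b c)
    (hcd : G.Adj c d) (hda : G.Adj d a) (hac : a ≠ c) (hbd : b ≠ d) : False := by
  have hcyc : (Walk.cons hab (Walk.cons hbc (Walk.cons hcd (Walk.cons hda Walk.nil)))).IsCycle := by
    simp [Walk.cons_isCycle_iff, Walk.cons_isPath_iff, hab.ne, hbc.ne, hcd.ne, hab.ne',
      hda.ne, hda.ne', hac, hac.symm, hbd]
  have := girth_le_length hcyc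
  simp at this
  omega

/-- Parents are unique: geodesics to `v` through `w₁` and `w₂` are the same path, so their
penultimate vertices agree. -/
theorem IsAcyclic.eq_of_adj_of_dist_eq (hG : G.IsAcyclic) {r v w₁ w₂ : V} (hr : G.Reachable r v)
    (h₁ : G.Adj w₁ v) (h₂ : G.Adj w₂ v) (hd₁ : G.dist r v = G.dist r w₁ + 1)
    (hd₂ : G.dist r v = G.dist r w₂ + 1) : w₁ = w₂ := by
  have key : ∀ w, G.Adj w v → G.dist r v = G.dist r w + 1 →
      ∃ (p : G.Walk r w) (h : G.Adj w v), (p.concat h).IsPath := fun w hw hd => by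
    obtain ⟨p, hp⟩ := (hr.trans hw.symm.reachable).exists_walk_length_eq_dist
    exact ⟨p, hw, Walk.isPath_of_length_eq_dist _ (by rw [Walk.length_concat, hp, hd])⟩
  obtain ⟨p, hp, hpp⟩ := key w₁ h₁ hd₁
  obtain ⟨q, hq, hqq⟩ := key w₂ h₂ hd₂
  have := congrArg (fun x : G.Path r v => x.1.penultimate)
    ((hG.subsingleton_path r v).elim ⟨_, hpp⟩ ⟨_, hqq⟩)
  simpa using this

theorem not_isAcyclic_of_isRegularOfDegree [Fintype V] [Nonempty V] [DecidableRel G.Adj] {d : ℕ}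
    (hd : 2 ≤ d) (hG : G.IsRegularOfDegree d) : ¬ G.IsAcyclic := by
  classical
  intro hac
  obtain ⟨r⟩ := ‹Nonempty V›
  -- Every neighbour of a vertex farthest from `r` would be its parent, yet it has at least two
  -- neighbours.
  obtain ⟨v, hv, hmax⟩ := Finset.exists_max_image ({v | G.Reachable r v} : Finset V) (G.dist r)
    ⟨r, by simp⟩
  simp only [Finset.mem_filter, Finset.mem_univ, true_and] at hv hmax
  have h1 : 1 < (G.neighborFinset v).card := by
    rw [G.card_neighborFinset_eq_degree, hG.degree_eq]
    omega
  obtain ⟨a, ha, b, hb, hab⟩ := Finset.one_lt_card.1 h1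
  simp only [mem_neighborFinset] at ha hb
  have key : ∀ w, G.Adj v w → G.dist r v = G.dist r w + 1 := fun w hw => by
    rcases hac.dist_eq_dist_add_one_of_adj_of_reachable r hw hv with h | h
    · exact h
    · have := hmax w (hv.trans hw.reachable)
      omega
  exact hab (hac.eq_of_adj_of_dist_eq hv ha.symm hb.symm (key a ha) (key b hb))

/-! ### Star covers of trees. -/

/-- The star formed by `v` and its children, when the graph is rooted at `r`. -/
def childStar (G : SimpleGraph V) (r v : V) : G.Subgraph where
  verts := {u | u = v ∨ G.Adj v u ∧ G.dist r u = G.dist r v + 1}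
  Adj a b := G.Adj a b ∧
    (a = v ∧ G.dist r b = G.dist r v + 1 ∨ b = v ∧ G.dist r a = G.dist r v + 1)
  adj_sub h := h.1
  edge_vert := by
    rintro a b ⟨h, ⟨rfl, -⟩ | ⟨rfl, h'⟩⟩
    · exact Or.inl rfl
    · exact Or.inr ⟨h.symm, h'⟩
  symm := ⟨fun a b h => ⟨h.1.symm, h.2.symm⟩⟩

theorem isStar_childStar (G : SimpleGraph V) (r v : V) : (G.childStar r v).IsStar := by
  refine ⟨⟨v, Or.inl rfl⟩, ?_⟩
  ext ⟨a, ha⟩ ⟨b, hb⟩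
  simp only [Subgraph.coe_adj, starGraph_adj, ne_eq, Subtype.ext_iff]
  constructor
  · rintro ⟨h, h'⟩
    exact ⟨h.ne, h'.imp And.left And.left⟩
  · rintro ⟨hne, rfl | rfl⟩
    · rcases hb with rfl | ⟨h, h'⟩
      · exact absurd rfl hne
      · exact ⟨h, Or.inl ⟨rfl, h'⟩⟩
    · rcases ha with rfl | ⟨h, h'⟩
      · exact absurd rfl hne
      · exact ⟨h.symm, Or.inr ⟨rfl, h'⟩⟩

open Classical in
theorem IsTree.exists_star_cover [Finite V] (hG : G.IsTree) :
    ∃ w : G.Subgraph →₀ ℝ, IsFractionalEdgeCover (fun H => H.IsStar) w ∧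
      (∀ H, w H = 0 ∨ w H = 1) ∧ ∀ v, vertexWeight w v ≤ 2 := by
  obtain ⟨r⟩ := hG.connected.nonempty
  have := Fintype.ofFinite V
  set w : G.Subgraph →₀ ℝ := Finsupp.equivFunOnFinite.symm
    (fun H => if H ∈ Set.range (G.childStar r) then 1 else 0) with hw
  have hwH : ∀ H, w H = if H ∈ Set.range (G.childStar r) then 1 else 0 := fun H => rfl
  have hw01 : ∀ H, w H = 0 ∨ w H = 1 := fun H => by
    rw [hwH]; split_ifs <;> simp
  have hw0 : ∀ H, 0 ≤ w H := fun H => by rcases hw01 H with h | h <;> simp [h]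
  have hw1 : ∀ H, w H ≤ 1 := fun H => by rcases hw01 H with h | h <;> simp [h]
  have hmem : ∀ H, w H ≠ 0 → ∃ v, G.childStar r v = H := fun H h => by
    by_contra hcon
    exact h ((hwH H).trans (if_neg hcon))
  have hone : ∀ v, w (G.childStar r v) = 1 := fun v => by
    rw [hwH, if_pos ⟨v, rfl⟩]
  refine ⟨w, ⟨hw0, fun H hH => ?_, fun u v huv => ?_⟩, hw01, fun v => ?_⟩
  · obtain ⟨v, rfl⟩ := hmem H hH
    exact G.isStar_childStar r v
  · have key : ∃ c, (G.childStar r c).Adj u v := by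
      rcases hG.dist_eq_dist_add_one_of_adj r huv with h | h
      · exact ⟨v, huv, Or.inr ⟨rfl, h⟩⟩
      · exact ⟨u, huv, Or.inl ⟨rfl, h⟩⟩
    obtain ⟨c, hc⟩ := key
    rw [edgeWeight, ← hone c]
    refine Finset.single_le_sum (fun H _ => hw0 H) ?_
    simp [hone, hc]
  · have key : ∃ p, ∀ H, w H ≠ 0 → v ∈ H.verts →
        H = G.childStar r v ∨ H = G.childStar r p := by
      by_cases hp : ∃ p, G.Adj p v ∧ G.dist r v = G.dist r p + 1
      · obtain ⟨p, hp, hpd⟩ := hp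
        refine ⟨p, fun H hH hv => ?_⟩
        obtain ⟨c, rfl⟩ := hmem H hH
        rcases hv with rfl | ⟨hv, hvd⟩
        · exact Or.inl rfl
        · rw [hG.isAcyclic.eq_of_adj_of_dist_eq (hG.connected r v) hv hp hvd hpd]
          exact Or.inr rfl
      -- Without a parent, `v` lies only in its own star; `p := v` is a dummy.
      · refine ⟨v, fun H hH hv => ?_⟩
        obtain ⟨c, rfl⟩ := hmem H hH
        rcases hv with rfl | hv
        · exact Or.inl rfl
        · exact absurd ⟨c, hv⟩ hp
    obtain ⟨p, hp⟩ := key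
    calc vertexWeight w v
        ≤ ∑ H ∈ {G.childStar r v, G.childStar r p}, w H := by
          refine Finset.sum_le_sum_of_subset_of_nonneg (fun H hH => ?_) fun H _ _ => hw0 H
          simp only [Finset.mem_filter, Finsupp.mem_support_iff] at hH
          simpa using hp H hH.1 hH.2
      _ ≤ (Finset.card {G.childStar r v, G.childStar r p}) • (1 : ℝ) :=
          Finset.sum_le_card_nsmul _ _ _ fun H _ => hw1 H
      _ ≤ 2 := by
          rw [nsmul_one]
          exact_mod_cast Finset.card_le_two

end SimpleGraph

/-! ### Regular graphs of large girth. -/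

/-- Reduced words of length at most `r` in `d` involutive letters. -/
abbrev ReducedWord (d r : ℕ) : Type :=
  {l : List (Fin d) // l.length ≤ r ∧ l.IsChain (· ≠ ·)}

namespace ReducedWord

variable {d r : ℕ}

instance : Finite (ReducedWord d r) :=
  ((List.finite_length_le (Fin d) r).subset fun _ h => h.1).to_subtype

/-- Left multiplication of a word by a letter: cancel it if it is the first letter, else prepend
it if the length allows. -/
def step (r : ℕ) (i : Fin d) : List (Fin d) → List (Fin d)
  | [] => if 0 < r then [i] else []
  | j :: t => if i = j then t else if t.length + 1 < r then i :: j :: t else j :: t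

theorem step_mem (i : Fin d) {l : List (Fin d)} (h : l.length ≤ r ∧ l.IsChain (· ≠ ·)) :
    (step r i l).length ≤ r ∧ (step r i l).IsChain (· ≠ ·) := by
  cases l with
  | nil => by_cases hr : 0 < r <;> simp [step, hr]; omega
  | cons j t =>
    simp only [step]
    split_ifs with h1 h2
    · exact ⟨(Nat.le_succ _).trans h.1, h.2.tail⟩
    · exact ⟨by simp; omega, List.isChain_cons_cons.2 ⟨h1, h.2⟩⟩
    · exact h

theorem step_step (i : Fin d) {l : List (Fin d)} (h : l.length ≤ r ∧ l.IsChain (· ≠ ·)) :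
    step r i (step r i l) = l := by
  cases l with
  | nil => by_cases hr : 0 < r <;> simp [step, hr]
  | cons j t =>
    by_cases hij : i = j
    · subst hij
      have hlen : t.length + 1 ≤ r := by simpa using h.1
      cases t with
      | nil => simp [step]; omega
      | cons k s =>
        have hik : i ≠ k := (List.isChain_cons_cons.1 h.2).1
        simp only [List.length_cons] at hlen
        simp [step, hik]
        omega
    · by_cases ht : t.length + 1 < r <;> simp [step, hij, ht]

theorem step_of_isChain {i : Fin d} {l : List (Fin d)} (hr : l.length < r)
    (h : (i :: l).IsChain (· ≠ ·)) : step r i l = i :: l := by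
  cases l with
  | nil => simpa [step, Nat.pos_iff_ne_zero] using hr
  | cons j t =>
    have hij : i ≠ j := (List.isChain_cons_cons.1 h).1
    simp only [List.length_cons] at hr
    simp [step, hij, hr]

/-- The involution of the reduced words given by a letter. -/
def generator (r : ℕ) (i : Fin d) : Equiv.Perm (ReducedWord d r) :=
  Function.Involutive.toPerm (fun l => ⟨step r i l.1, step_mem i l.2⟩)
    fun l => Subtype.ext (step_step i l.2)

@[simp]
theorem coe_generator_apply (i : Fin d) (l : ReducedWord d r) :
    (generator r i l : List (Fin d)) = step r i l := rfl

@[simp]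
theorem generator_mul_self (i : Fin d) : generator r i * generator r i = 1 :=
  Equiv.ext fun l => Subtype.ext (step_step i l.2)

/-- The empty word. -/
def empty : ReducedWord d r := ⟨[], by simp⟩

/-- Acting on the empty word spells out `l`, so no nonempty reduced word of length at most `r` acts
as the identity. -/
theorem coe_prod_generator_apply_empty {l : List (Fin d)} (hr : l.length ≤ r)
    (h : l.IsChain (· ≠ ·)) :
    ((l.map (generator r)).prod empty : List (Fin d)) = l := by
  induction l with
  | nil => rfl
  | cons i t ih =>
    simp only [List.length_cons] at hr
    rw [List.map_cons, List.prod_cons, Equiv.Perm.mul_apply, coe_generator_apply,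
      ih (by omega) h.tail, step_of_isChain (by omega) h]

theorem coe_generator_apply_empty (hr : 0 < r) (i : Fin d) :
    (generator r i empty : List (Fin d)) = [i] := by
  simp [empty, step, hr]

theorem generator_injective (hr : 0 < r) : Function.Injective (generator (d := d) r) :=
  fun i j h => by
    have := congrArg (fun p => (p (empty : ReducedWord d r) : List (Fin d))) h
    simpa only [coe_generator_apply_empty hr, List.cons.injEq, and_true] using this

theorem generator_ne_one (hr : 0 < r) (i : Fin d) : generator r i ≠ 1 := fun h => by
  have := coe_generator_apply_empty hr i
  rw [h] at this
  simp [empty] at this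

/-- The Cayley graph of the permutation group of the reduced words with respect to the
generators. -/
def cayleyGraph (d r : ℕ) : SimpleGraph (Equiv.Perm (ReducedWord d r)) where
  Adj a b := a ≠ b ∧ ∃ i, b = a * generator r i
  symm := ⟨by
    rintro a b ⟨hne, i, rfl⟩
    exact ⟨hne.symm, i, by rw [mul_assoc, generator_mul_self, mul_one]⟩⟩
  loopless := ⟨fun a h => h.1 rfl⟩

theorem cayleyGraph_adj_iff (hr : 0 < r) {a b : Equiv.Perm (ReducedWord d r)} :
    (cayleyGraph d r).Adj a b ↔ ∃ i, b = a * generator r i := by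
  refine ⟨And.right, fun h => ⟨?_, h⟩⟩
  rintro rfl
  obtain ⟨i, hi⟩ := h
  exact generator_ne_one hr i (left_eq_mul.1 hi)

open Classical in
theorem isRegularOfDegree_cayleyGraph [Fintype (Equiv.Perm (ReducedWord d r))]
    [DecidableRel (cayleyGraph d r).Adj] (hr : 0 < r) :
    (cayleyGraph d r).IsRegularOfDegree d := fun a => by
  have : (cayleyGraph d r).neighborFinset a =
      Finset.univ.image fun i => a * generator r i := by
    ext b
    simp [cayleyGraph_adj_iff hr, eq_comm]
  rw [← SimpleGraph.card_neighborFinset_eq_degree, this,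
    Finset.card_image_of_injective _ fun i j h => generator_injective hr (mul_left_cancel h),
    Finset.card_univ, Fintype.card_fin]

/-- Generators are involutions, so a repeated letter would retrace the edge just used. The clause on
`head?` records the first edge so that the induction can see this. -/
theorem exists_word_of_isTrail {a b : Equiv.Perm (ReducedWord d r)}
    (p : (cayleyGraph d r).Walk a b) (hp : p.IsTrail) :
    ∃ l : List (Fin d), l.length = p.length ∧ l.IsChain (· ≠ ·) ∧
      b = a * (l.map (generator r)).prod ∧
      ∀ i ∈ l.head?, s(a, a * generator r i) ∈ p.edges := by
  induction p with
  | nil => exact ⟨[], by simp⟩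
  | @cons a c b h q ih =>
    rw [SimpleGraph.Walk.isTrail_cons] at hp
    obtain ⟨l, hlen, hchain, hprod, hhead⟩ := ih hp.1
    obtain ⟨i, rfl⟩ := h.2
    refine ⟨i :: l, by simp [hlen], hchain.cons ?_, ?_, ?_⟩
    · rintro j hj rfl
      have := hhead _ hj
      rw [mul_assoc, generator_mul_self, mul_one, Sym2.eq_swap] at this
      exact hp.2 this
    · rw [hprod, List.map_cons, List.prod_cons, mul_assoc]
    · simp

theorem lt_length_of_isCycle {a : Equiv.Perm (ReducedWord d r)}
    (p : (cayleyGraph d r).Walk a a) (hp : p.IsCycle) : r < p.length := by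
  by_contra! hlen
  obtain ⟨l, hl, hchain, hprod, -⟩ := exists_word_of_isTrail p hp.isTrail
  have h := coe_prod_generator_apply_empty (r := r) (by omega) hchain
  rw [left_eq_mul.1 hprod] at h
  have h3 := hp.three_le_length
  rw [← hl, ← h] at h3
  simp [empty] at h3

end ReducedWord

theorem SimpleGraph.exists_isRegularOfDegree_lt_girth {d : ℕ} (hd : 2 ≤ d) (g : ℕ) :
    ∃ (n : ℕ) (G : SimpleGraph (Fin n)) (_ : DecidableRel G.Adj),
      Nonempty (Fin n) ∧ G.IsRegularOfDegree d ∧ ¬ G.IsAcyclic ∧ g < G.girth := by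
  classical
  have := Fintype.ofFinite (Equiv.Perm (ReducedWord d (g + 1)))
  let C := ReducedWord.cayleyGraph d (g + 1)
  have hreg : C.IsRegularOfDegree d := ReducedWord.isRegularOfDegree_cayleyGraph (by omega)
  have hcyc : ¬ C.IsAcyclic := not_isAcyclic_of_isRegularOfDegree hd hreg
  have hgirth : g < C.girth := by
    obtain ⟨a, p, hp, hlen⟩ := exists_girth_eq_length.2 hcyc
    rw [hlen]
    exact (Nat.lt_succ_self g).trans (ReducedWord.lt_length_of_isCycle p hp)
  let e := C.overFinIso rfl
  refine ⟨_, C.overFin rfl, Classical.decRel _, ⟨e 1⟩, fun v => ?_, ?_, ?_⟩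
  · rw [← e.apply_symm_apply v, e.degree_eq]
    exact hreg _
  · rwa [← e.isAcyclic_iff]
  · rwa [← e.girth_eq]

theorem mainTheorem4 :
    -- regular graphs of arbitrarily large (finite) girth and large cover weight
    (∀ d : ℕ, 2 ≤ d → ∀ g : ℕ,
      ∃ (n : ℕ) (G : SimpleGraph (Fin n)) (_ : DecidableRel G.Adj),
        G.IsRegularOfDegree d ∧ ¬ G.IsAcyclic ∧ g < G.girth ∧
        (∀ w : G.Subgraph →₀ ℝ, IsFractionalEdgeCover (fun H => H.IsStar) w →
          ∃ v, ((d : ℝ) + 1) / 2 ≤ vertexWeight w v) ∧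
        (∀ w : G.Subgraph →₀ ℝ, IsFractionalEdgeCover (fun H => H.IsMultipartite) w →
          ∃ v, ((d : ℝ) + 1) / 2 ≤ vertexWeight w v)) ∧
    -- every finite tree has an integral star cover that covers each vertex at most twice
    (∀ (V : Type*) [Finite V] (T : SimpleGraph V), T.IsTree →
      ∃ w : T.Subgraph →₀ ℝ, IsFractionalEdgeCover (fun H => H.IsStar) w ∧
        (∀ H, w H = 0 ∨ w H = 1) ∧ ∀ v, vertexWeight w v ≤ 2) := by
  refine ⟨fun d hd g => ?_, fun V _ T hT => hT.exists_star_cover⟩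
  obtain ⟨n, G, hdec, hne, hreg, hcyc, hgirth⟩ :=
    -- The extra 4 excludes triangles and 4-cycles for every `g`.
    SimpleGraph.exists_isRegularOfDegree_lt_girth hd (g + 4)
  refine ⟨n, G, hdec, hreg, hcyc, by omega, fun w hw => ?_, fun w hw => ?_⟩
  · exact exists_le_vertexWeight_of_isStarOrEdgeless (by omega) hreg
      (fun H hH => hH.isStarOrEdgeless) hw
  · exact exists_le_vertexWeight_of_isStarOrEdgeless (by omega) hreg
      (fun H hH => hH.isStarOrEdgeless (SimpleGraph.no_triangle_of_girth (by omega))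
        (SimpleGraph.no_square_of_girth (by omega))) hw
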